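/- Let $p$ be a prime and let $\phi(x)=\frac{ax+b}{cx+d}$ with $a,b,c,d\in\mathbb{Q}_p$ and $ad-bc\neq 0$, regarded as a bijection of the projective line $\mathbb{P}^1(\mathbb{Q}_p)=\mathbb{Q}_p\cup\{\infty\}$. Suppose that $\phi$ has no fixed point in $\mathbb{P}^1(\mathbb{Q}_p)$ and that $\phi^n\neq \mathrm{id}$ for all integers $n>0$. A minimal subsystem of $\phi$ is a pair $(E,\phi|_E)$ where $E\subseteq\mathbb{P}^1(\mathbb{Q}_p)$ is a nonempty compact set with $\phi(E)\subseteq E$ such that $E=\overline{\{\phi^n(x):n\geq 0\}}$ for each $x\in E$. For a sequence $(p_s)$ of positive integers with $p_s\mid p_{s+1}$ for all $s$, the odometer $\mathbb{Z}_{(p_s)}$ is the inverse limit $\varprojlim \mathbb{Z}/p_s\mathbb{Z}$, a subspace of the product of the discrete spaces $\mathbb{Z}/p_s\mathbb{Z}$, and the adding machine on it is the map $x\mapsto x+1$. Then there is a positive integer $k$ dividing $p+1$ such that every minimal subsystem of $\phi$ is topologically conjugate to the adding machine on the odometer $\mathbb{Z}_{(p_s)}$ with $(p_s)=(k,kp,kp^2,\dots)$.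 -/

import Mathlib

/-- The homographic map `x ↦ (a x + b) / (c x + d)`, `ad - bc ≠ 0`, on the projective line
`P¹(K) = K ∪ {∞}`, given by Mathlib's action of `GL₂(K)` on `OnePoint K`. -/
noncomputable def homographic {K : Type*} [Field K] [DecidableEq K] (a b c d : K)
    (h : a * d - b * c ≠ 0) (x : OnePoint K) : OnePoint K :=
  Matrix.GeneralLinearGroup.mkOfDetNeZero !![a, b; c, d] (by rwa [Matrix.det_fin_two_of]) • x

/-- The value of a homographic map at a finite point. -/
theorem homographic_coe {K : Type*} [Field K] [DecidableEq K] (a b c d : K)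
    (h : a * d - b * c ≠ 0) (x : K) :
    homographic a b c d h (x : OnePoint K) =
      if c * x + d = 0 then OnePoint.infty else (((a * x + b) / (c * x + d) : K) : OnePoint K) := by
  simp [homographic, OnePoint.smul_some_eq_ite, Matrix.GeneralLinearGroup.mkOfDetNeZero]

/-- The value of a homographic map at infinity. -/
theorem homographic_infty {K : Type*} [Field K] [DecidableEq K] (a b c d : K)
    (h : a * d - b * c ≠ 0) :
    homographic a b c d h OnePoint.infty =
      if c = 0 then OnePoint.infty else ((a / c : K) : OnePoint K) := by
  simp [homographic, OnePoint.smul_infty_eq_ite, Matrix.GeneralLinearGroup.mkOfDetNeZero]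

/-- The forward orbit `{fⁿ(x) : n ≥ 0}`. -/
def forwardOrbit {X : Type*} (f : X → X) (x : X) : Set X :=
  Set.range fun n : ℕ => f^[n] x

/-- `(E, f)` is a minimal subsystem: `E` is a nonempty compact set with `f(E) ⊆ E`, equal to the
closure of the forward orbit of each of its points. -/
structure IsMinimalSubsystem {X : Type*} [TopologicalSpace X] (f : X → X) (E : Set X) : Prop where
  nonempty : E.Nonempty
  isCompact : IsCompact E
  mapsTo : Set.MapsTo f E E
  closure_orbit : ∀ x ∈ E, closure (forwardOrbit f x) = E

/-- Topological conjugacy of two dynamical systems. -/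
def TopologicallyConjugate {X Y : Type*} [TopologicalSpace X] [TopologicalSpace Y]
    (f : X → X) (g : Y → Y) : Prop :=
  ∃ h : X ≃ₜ Y, Function.Semiconj h f g

/-- A sequence of positive integers, each of which divides the next one. -/
structure OdometerScale where
  seq : ℕ → ℕ
  pos : ∀ s, 0 < seq s
  dvd : ∀ s, seq s ∣ seq (s + 1)

/-- The odometer of a scale `(p_s)`: the inverse limit of the rings `ℤ/p_s`, a subring of their
product with the topology induced by the product of the discrete topologies. -/
def odometer (q : OdometerScale) : Subring (∀ s, ZMod (q.seq s)) where
  carrier := {x | ∀ s, ZMod.castHom (q.dvd s) (ZMod (q.seq s)) (x (s + 1)) = x s}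
  mul_mem' hx hy s := by
    rw [Pi.mul_apply, map_mul, hx s, hy s, Pi.mul_apply]
  one_mem' s := by
    rw [Pi.one_apply, map_one, Pi.one_apply]
  add_mem' hx hy s := by
    rw [Pi.add_apply, map_add, hx s, hy s, Pi.add_apply]
  zero_mem' s := by
    rw [Pi.zero_apply, map_zero, Pi.zero_apply]
  neg_mem' hx s := by
    rw [Pi.neg_apply, map_neg, hx s, Pi.neg_apply]

/-- The adding machine `x ↦ x + 1` on an odometer. -/
def addingMachine (q : OdometerScale) (x : odometer q) : odometer q := x + 1

/-- The sequence `(k, kp, kp², …)`. -/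
def geometricScale (k p : ℕ) (hk : 0 < k) (hp : 0 < p) : OdometerScale where
  seq s := k * p ^ s
  pos s := Nat.mul_pos hk (Nat.pow_pos hp)
  dvd s := Nat.mul_dvd_mul_left k (pow_dvd_pow p (Nat.le_succ s))

/-! A fixed point-free `φ` has two conjugate irrational fixed points `α`, `β`. In the coordinate
`h(x) = (x - α)/(x - β)`, injective and continuous on the projective line, `φ` becomes
multiplication by a ratio `u` of eigenvalues of its matrix, and `u` is not a root of unity because
no `φⁿ` is the identity.

A conjugation `σ` swaps `α` and `β`, so `σ u = u⁻¹`. Since `σ` is an isometry, `‖u‖ = 1`, and `u +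
u⁻¹` lies in `ℤ_[p]`. The residue `v` of `u` and its inverse are thus the roots of a quadratic over
the prime field, which Frobenius permutes: either `v ^ p = v⁻¹`, or `v` is in the prime field, and
then the isometry `σ` forces `v = v⁻¹`. Either way `v ^ (p + 1) = 1`. Take `k` to be the order of
`v`; it does not depend on `E`.

As `u ^ k ≡ 1` modulo the maximal ideal, `u ^ (k * p ^ s) → 1`, so `n ↦ uⁿ` extends continuously to
the odometer (`odometerPow`). The extension is injective (`odometerPow_injective`) and turns adding
one into multiplication by `u`. By compactness its image, scaled by `h(x₀)`, is `h(E)` for any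
minimal `E` containing `x₀`. -/

open Filter Topology

/-! ### Powers of a norm one element -/

section PowersNearOne

variable {K : Type*} [NormedField K] [IsUltrametricDist K]

/-- The exponents `n` for which `uⁿ` lies in the closed ball of radius `ε` around `1`. -/
def nearOneExponents (u : K) (hu : ‖u‖ = 1) (ε : ℝ) (hε : 0 ≤ ε) : AddSubgroup ℤ where
  carrier := {n | ‖u ^ n - 1‖ ≤ ε}
  zero_mem' := by simpa using hε
  add_mem' {m n} hm hn := by
    have hu0 : u ≠ 0 := norm_ne_zero_iff.1 (by simp [hu])
    have e : u ^ (m + n) - 1 = u ^ m * (u ^ n - 1) + (u ^ m - 1) := by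
      rw [zpow_add₀ hu0]; ring
    simp only [Set.mem_ofPred_eq] at hm hn ⊢
    rw [e]
    refine (IsUltrametricDist.norm_add_le_max _ _).trans (max_le ?_ hm)
    simpa [norm_mul, norm_zpow, hu] using hn
  neg_mem' {n} hn := by
    have hu0 : u ≠ 0 := norm_ne_zero_iff.1 (by simp [hu])
    have hn0 : u ^ n ≠ 0 := zpow_ne_zero _ hu0
    have e : u ^ (-n) - 1 = -(u ^ (-n) * (u ^ n - 1)) := by
      rw [zpow_neg]; field_simp; ring
    simp only [Set.mem_ofPred_eq] at hn ⊢
    rw [e, norm_neg, norm_mul, norm_zpow, hu]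
    simpa using hn

theorem mem_nearOneExponents {u : K} {hu : ‖u‖ = 1} {ε : ℝ} {hε : 0 ≤ ε} {n : ℤ} :
    n ∈ nearOneExponents u hu ε hε ↔ ‖u ^ n - 1‖ ≤ ε := Iff.rfl

theorem natCast_mem_nearOneExponents {u : K} {hu : ‖u‖ = 1} {ε : ℝ} {hε : 0 ≤ ε} {n : ℕ} :
    (n : ℤ) ∈ nearOneExponents u hu ε hε ↔ ‖u ^ n - 1‖ ≤ ε := by
  rw [mem_nearOneExponents, zpow_natCast]

theorem norm_pow_sub_one_le_of_dvd {u : K} (hu : ‖u‖ = 1) {m n : ℕ} (h : m ∣ n) :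
    ‖u ^ n - 1‖ ≤ ‖u ^ m - 1‖ := by
  obtain ⟨c, rfl⟩ := h
  rw [← natCast_mem_nearOneExponents (hu := hu) (hε := norm_nonneg _)]
  have : (m : ℤ) ∈ nearOneExponents u hu ‖u ^ m - 1‖ (norm_nonneg _) :=
    natCast_mem_nearOneExponents.2 le_rfl
  simpa [mul_comm] using AddSubgroup.zsmul_mem _ this c

/-- The distance of two powers is controlled by the difference of the exponents. -/
theorem norm_pow_sub_pow_le_iff {u : K} (hu : ‖u‖ = 1) {ε : ℝ} (hε : 0 ≤ ε) (m n : ℕ) :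
    ‖u ^ m - u ^ n‖ ≤ ε ↔ (m : ℤ) - n ∈ nearOneExponents u hu ε hε := by
  have hu0 : u ≠ 0 := norm_ne_zero_iff.1 (by simp [hu])
  have e : u ^ m - u ^ n = u ^ n * (u ^ ((m : ℤ) - n) - 1) := by
    rw [zpow_sub₀ hu0, zpow_natCast, zpow_natCast]
    field_simp
  rw [mem_nearOneExponents, e, norm_mul, norm_pow, hu, one_pow, one_mul]

theorem norm_pow_sub_pow_le {u : K} (hu : ‖u‖ = 1) {N m n : ℕ} (h : (m : ZMod N) = n) :
    ‖u ^ m - u ^ n‖ ≤ ‖u ^ N - 1‖ := by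
  rw [norm_pow_sub_pow_le_iff hu (norm_nonneg _)]
  obtain ⟨c, hc⟩ : (N : ℤ) ∣ (m : ℤ) - n := by
    rw [← ZMod.intCast_zmod_eq_zero_iff_dvd]
    simp [h]
  rw [hc, mul_comm]
  exact AddSubgroup.zsmul_mem _ (natCast_mem_nearOneExponents.2 le_rfl) c

end PowersNearOne

/-! ### Odometers and the extension of `n ↦ uⁿ` -/

section Odometer

instance OdometerScale.neZero_seq (q : OdometerScale) (s : ℕ) : NeZero (q.seq s) :=
  ⟨(q.pos s).ne'⟩

theorem OdometerScale.seq_dvd_seq (q : OdometerScale) {s t : ℕ} (h : s ≤ t) :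
    q.seq s ∣ q.seq t := by
  induction t, h using Nat.le_induction with
  | base => exact dvd_rfl
  | succ t _ ih => exact ih.trans (q.dvd t)

instance odometer.compactSpace (q : OdometerScale) : CompactSpace (odometer q) := by
  have hc : IsClosed ((odometer q : Set (∀ s, ZMod (q.seq s)))) := by
    have : (odometer q : Set (∀ s, ZMod (q.seq s))) =
        ⋂ s, {x | ZMod.castHom (q.dvd s) (ZMod (q.seq s)) (x (s + 1)) = x s} := by
      ext x
      simp only [Set.mem_iInter]
      rfl
    rw [this]
    exact isClosed_iInter fun s =>
      isClosed_eq (continuous_of_discreteTopology.comp (continuous_apply _)) (continuous_apply _)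
  exact isCompact_iff_compactSpace.1 hc.isCompact

theorem odometer.natCast_val (q : OdometerScale) (z : odometer q) {s t : ℕ} (h : s ≤ t) :
    (((z.1 t).val : ℕ) : ZMod (q.seq s)) = z.1 s := by
  induction t, h using Nat.le_induction with
  | base => exact ZMod.natCast_zmod_val _
  | succ t hst ih =>
    rw [← ih, ← z.2 t, ZMod.castHom_apply, ← ZMod.natCast_val, ZMod.val_natCast]
    conv_lhs => rw [← Nat.mod_add_div (ZMod.val (z.1 (t + 1))) (q.seq t)]
    have h0 : ((q.seq t : ℕ) : ZMod (q.seq s)) = 0 :=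
      (ZMod.natCast_eq_zero_iff _ _).2 (q.seq_dvd_seq hst)
    push_cast
    rw [h0, zero_mul, add_zero]

theorem odometer.natCast_apply (q : OdometerScale) (n s : ℕ) : (n : odometer q).1 s = n := rfl

/-- The representative of the level `t` coordinate of `z` agrees with `z` at every level up to `t`,
so these representatives converge to `z`. -/
theorem odometer.denseRange_natCast (q : OdometerScale) :
    DenseRange (Nat.cast : ℕ → odometer q) := by
  intro z
  refine mem_closure_of_tendsto (f := fun s => (((z.1 s).val : ℕ) : odometer q)) (b := atTop) ?_
    (Eventually.of_forall fun s => Set.mem_range_self _)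
  rw [tendsto_subtype_rng, tendsto_pi_nhds]
  intro s
  refine tendsto_const_nhds.congr' ?_
  filter_upwards [eventually_ge_atTop s] with t ht
  exact (odometer.natCast_val q z ht).symm

theorem odometer.semiconj_natCast (q : OdometerScale) (n : ℕ) :
    addingMachine q n = (n + 1 : ℕ) := by
  simp [addingMachine]

variable {K : Type*} [NormedField K]

/-- The extension to the odometer of `n ↦ uⁿ`. -/
noncomputable def odometerPow (q : OdometerScale) (u : K) (z : odometer q) : K :=
  limUnder atTop fun s => u ^ (z.1 s).val

variable [IsUltrametricDist K] [CompleteSpace K] {q : OdometerScale} {u : K}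

theorem tendsto_odometerPow (hu : ‖u‖ = 1)
    (hq : Tendsto (fun s => ‖u ^ q.seq s - 1‖) atTop (𝓝 0)) (z : odometer q) :
    Tendsto (fun s => u ^ (z.1 s).val) atTop (𝓝 (odometerPow q u z)) := by
  refine CauchySeq.tendsto_limUnder (cauchySeq_of_le_tendsto_0' (fun s => ‖u ^ q.seq s - 1‖) ?_ hq)
  intro s t hst
  rw [dist_eq_norm]
  refine norm_pow_sub_pow_le hu ?_
  rw [odometer.natCast_val q z hst, ZMod.natCast_zmod_val]

/-- The bound does not depend on `z`: convergence is uniform, which gives continuity of the limit.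
-/
theorem norm_pow_sub_odometerPow_le (hu : ‖u‖ = 1)
    (hq : Tendsto (fun s => ‖u ^ q.seq s - 1‖) atTop (𝓝 0)) (z : odometer q) (s : ℕ) :
    ‖u ^ (z.1 s).val - odometerPow q u z‖ ≤ ‖u ^ q.seq s - 1‖ := by
  refine le_of_tendsto ((tendsto_const_nhds.sub (tendsto_odometerPow hu hq z)).norm) ?_
  filter_upwards [eventually_ge_atTop s] with t ht
  refine norm_pow_sub_pow_le hu ?_
  rw [odometer.natCast_val q z ht, ZMod.natCast_zmod_val]

theorem continuous_odometerPow (hu : ‖u‖ = 1)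
    (hq : Tendsto (fun s => ‖u ^ q.seq s - 1‖) atTop (𝓝 0)) :
    Continuous (odometerPow q u) := by
  have hunif : TendstoUniformly (fun s (z : odometer q) => u ^ (z.1 s).val) (odometerPow q u)
      atTop := by
    rw [Metric.tendstoUniformly_iff]
    intro ε hε
    filter_upwards [hq.eventually (gt_mem_nhds hε)] with s hs z
    rw [dist_comm, dist_eq_norm]
    exact (norm_pow_sub_odometerPow_le hu hq z s).trans_lt hs
  refine hunif.continuous (Frequently.of_forall fun s => ?_)
  exact (continuous_of_discreteTopology (f := fun r : ZMod (q.seq s) => u ^ r.val)).comp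
    ((continuous_apply s).comp continuous_subtype_val)

theorem odometerPow_natCast (hu : ‖u‖ = 1)
    (hq : Tendsto (fun s => ‖u ^ q.seq s - 1‖) atTop (𝓝 0)) (n : ℕ) :
    odometerPow q u n = u ^ n := by
  refine tendsto_nhds_unique (tendsto_odometerPow hu hq n) ?_
  rw [tendsto_iff_norm_sub_tendsto_zero]
  refine squeeze_zero (fun _ => norm_nonneg _) (fun s => norm_pow_sub_pow_le hu ?_) hq
  rw [ZMod.natCast_zmod_val, odometer.natCast_apply]

theorem odometerPow_addingMachine (hu : ‖u‖ = 1)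
    (hq : Tendsto (fun s => ‖u ^ q.seq s - 1‖) atTop (𝓝 0)) (z : odometer q) :
    odometerPow q u (addingMachine q z) = u * odometerPow q u z := by
  have hF := continuous_odometerPow hu hq
  have hc : Continuous (addingMachine q) := by
    refine Continuous.subtype_mk (f := fun z : odometer q => z.1 + 1) ?_ _
    exact continuous_pi fun s => (continuous_of_discreteTopology
      (f := fun r : ZMod (q.seq s) => r + 1)).comp
        ((continuous_apply s).comp continuous_subtype_val)
  refine congrFun ((odometer.denseRange_natCast q).equalizer (hF.comp hc)
    (continuous_const.mul hF) (funext fun n => ?_)) z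
  change odometerPow q u (addingMachine q n) = u * odometerPow q u n
  rw [odometer.semiconj_natCast, odometerPow_natCast hu hq, odometerPow_natCast hu hq, pow_succ']

end Odometer

/-! ### Injectivity on the scale `k, kp, kp², …` -/

section GeometricScale

variable {K : Type*} [NormedField K] [IsUltrametricDist K] [CompleteSpace K] {u : K}

/-- Exponents with `uⁿ` near `1` form a subgroup, hence are closed under gcd. A gcd with `k * p ^ s`
that is still a multiple of `k` has the form `k * p ^ j`, and `j` must be large because no `u ^ (k *
p ^ e)` equals `1`. -/
theorem odometerPow_injective {k p : ℕ} (hk : 0 < k) (hp : p.Prime) (hu : ‖u‖ = 1)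
    (hq : Tendsto (fun s => ‖u ^ (k * p ^ s) - 1‖) atTop (𝓝 0))
    (hne : ∀ n : ℕ, 0 < n → u ^ n ≠ 1) (hdvd : ∀ n : ℕ, ‖u ^ n - 1‖ < 1 → k ∣ n) :
    Function.Injective (odometerPow (geometricScale k p hk hp.pos) u) := by
  set q := geometricScale k p hk hp.pos
  intro z w hzw
  apply Subtype.ext
  funext e
  have hpos : 0 < ‖u ^ q.seq e - 1‖ := norm_pos_iff.2 (sub_ne_zero.2 (hne _ (q.pos e)))
  -- The level `s` is so deep that `u ^ q.seq s` is closer to `1` than `u ^ q.seq e`.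
  obtain ⟨s, hs, hs1, hse⟩ := ((hq.eventually (gt_mem_nhds hpos)).and
    ((hq.eventually (gt_mem_nhds one_pos)).and (eventually_ge_atTop e))).exists
  change ‖u ^ q.seq s - 1‖ < _ at hs
  change ‖u ^ q.seq s - 1‖ < _ at hs1
  set ε := ‖u ^ q.seq s - 1‖
  have hε : 0 ≤ ε := norm_nonneg _
  set n : ℤ := ((z.1 s).val : ℤ) - (w.1 s).val with hn
  have hnmem : n ∈ nearOneExponents u hu ε hε := by
    rw [hn, ← norm_pow_sub_pow_le_iff hu hε]
    have e1 := norm_pow_sub_odometerPow_le (q := q) hu hq z s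
    have e2 := norm_pow_sub_odometerPow_le (q := q) hu hq w s
    rw [← hzw, norm_sub_rev] at e2
    rw [← sub_add_sub_cancel _ (odometerPow q u z)]
    exact (IsUltrametricDist.norm_add_le_max _ _).trans (max_le e1 e2)
  have hNmem : ((q.seq s : ℕ) : ℤ) ∈ nearOneExponents u hu ε hε :=
    natCast_mem_nearOneExponents.2 le_rfl
  set g := Int.gcd n (q.seq s) with hg
  have hgmem : (g : ℤ) ∈ nearOneExponents u hu ε hε := by
    rw [hg, Int.gcd_eq_gcd_ab]
    refine add_mem ?_ ?_
    · rw [mul_comm]; exact AddSubgroup.zsmul_mem _ hnmem _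
    · rw [mul_comm]; exact AddSubgroup.zsmul_mem _ hNmem _
  rw [natCast_mem_nearOneExponents] at hgmem
  obtain ⟨c, hc⟩ := hdvd g (hgmem.trans_lt hs1)
  have hgN : g ∣ k * p ^ s := by
    have := Int.gcd_dvd_natAbs_right n (q.seq s)
    rwa [Int.natAbs_natCast] at this
  have hcp : c ∣ p ^ s := by
    rw [hc] at hgN
    exact Nat.dvd_of_mul_dvd_mul_left hk hgN
  obtain ⟨j, -, rfl⟩ := (Nat.dvd_prime_pow hp).1 hcp
  -- If `j < e`, then `g` divides `q.seq e`, so `u ^ q.seq e` would be within `ε` of `1`, against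
  -- the choice of `s`.
  have hej : e ≤ j := by
    by_contra! hlt
    have : ‖u ^ q.seq e - 1‖ ≤ ‖u ^ g - 1‖ :=
      norm_pow_sub_one_le_of_dvd hu (by rw [hc]; exact q.seq_dvd_seq hlt.le)
    linarith
  have hen : ((q.seq e : ℕ) : ℤ) ∣ n := by
    have h1 : q.seq e ∣ g := by rw [hc]; exact q.seq_dvd_seq hej
    exact (Int.natCast_dvd_natCast.2 h1).trans (Int.gcd_dvd_left _ _)
  rw [← ZMod.intCast_zmod_eq_zero_iff_dvd, hn] at hen
  push_cast at hen
  rw [odometer.natCast_val q z hse,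
    odometer.natCast_val q w hse, sub_eq_zero] at hen
  exact hen

end GeometricScale

/-! ### From a multiplicative coordinate to a conjugacy -/

section Conjugacy

theorem topologicallyConjugate_of_odometerPow {K : Type*} [NormedField K] [IsUltrametricDist K]
    [CompleteSpace K] {u : K} {q : OdometerScale} (hu : ‖u‖ = 1)
    (hq : Tendsto (fun s => ‖u ^ q.seq s - 1‖) atTop (𝓝 0))
    (hinj : Function.Injective (odometerPow q u))
    {X : Type*} [TopologicalSpace X] [T2Space X] {f : X → X} {h : X → K} (hc : Continuous h)
    (hi : Function.Injective h) (h0 : ∀ x, h x ≠ 0) (hf : ∀ x, h (f x) = u * h x)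
    {E : Set X} (hE : IsMinimalSubsystem f E) :
    TopologicallyConjugate (Set.MapsTo.restrict f E E hE.mapsTo) (addingMachine q) := by
  obtain ⟨x₀, hx₀⟩ := hE.nonempty
  have hiter (n : ℕ) : h (f^[n] x₀) = h x₀ * u ^ n := by
    induction n with
    | zero => simp
    | succ n ih => rw [Function.iterate_succ_apply', hf, ih]; ring
  have hF := continuous_odometerPow hu hq
  let g : odometer q → K := fun z => h x₀ * odometerPow q u z
  have hg : Continuous g := continuous_const.mul hF
  have hginj : Function.Injective g := fun z w hzw => hinj (mul_left_cancel₀ (h0 x₀) hzw)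
  have hgnat (n : ℕ) : g n = h (f^[n] x₀) := by
    rw [hiter]; exact congrArg _ (odometerPow_natCast hu hq n)
  -- Both sets are compact, and each is governed by the points `h (f^[n] x₀)`: naturals are dense in
  -- the odometer, the orbit is dense in `E`.
  have hrange : Set.range g = h '' E := by
    apply Set.Subset.antisymm
    · rintro _ ⟨z, rfl⟩
      have hcl : IsClosed (g ⁻¹' (h '' E)) := (hE.isCompact.image hc).isClosed.preimage hg
      have := (odometer.denseRange_natCast q).induction_on
        (p := fun z => g z ∈ h '' E) z hcl fun n => by
          rw [hgnat, ← hE.closure_orbit x₀ hx₀]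
          exact ⟨_, subset_closure ⟨n, rfl⟩, rfl⟩
      exact this
    · rintro _ ⟨x, hx, rfl⟩
      have hcl : IsClosed (h ⁻¹' Set.range g) := (isCompact_range hg).isClosed.preimage hc
      rw [← hE.closure_orbit x₀ hx₀] at hx
      refine closure_minimal ?_ hcl hx
      rintro _ ⟨n, rfl⟩
      exact ⟨n, hgnat n⟩
  have hex (z : odometer q) : ∃ x : E, h x = g z := by
    obtain ⟨x, hx, hxz⟩ : g z ∈ h '' E := hrange ▸ Set.mem_range_self z
    exact ⟨⟨x, hx⟩, hxz⟩
  choose θ hθ using hex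
  have hθb : Function.Bijective θ := by
    constructor
    · intro z w hzw
      exact hginj (by rw [← hθ, ← hθ, hzw])
    · rintro ⟨x, hx⟩
      obtain ⟨z, hz⟩ : h x ∈ Set.range g := hrange ▸ Set.mem_image_of_mem h hx
      exact ⟨z, Subtype.ext (hi ((hθ z).trans hz))⟩
  have := isCompact_iff_compactSpace.1 hE.isCompact
  have hemb : IsClosedEmbedding fun x : E => h x :=
    (hc.comp continuous_subtype_val).isClosedEmbedding (hi.comp Subtype.val_injective)
  have hθc : Continuous θ := by
    rw [hemb.continuous_iff]
    exact hg.congr fun z => (hθ z).symm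
  let H : odometer q ≃ₜ E := Continuous.homeoOfEquivCompactToT2 (f := Equiv.ofBijective θ hθb) hθc
  have hsemi : Function.Semiconj H (addingMachine q) (Set.MapsTo.restrict f E E hE.mapsTo) := by
    intro z
    apply Subtype.ext
    apply hi
    change h (θ _) = h (f (θ z))
    rw [hθ, hf, hθ]
    change h x₀ * _ = u * (h x₀ * _)
    rw [odometerPow_addingMachine hu hq]
    ring
  refine ⟨H.symm, fun x => ?_⟩
  apply H.injective
  rw [hsemi, H.apply_symm_apply, H.apply_symm_apply]

end Conjugacy

/-! ### Residues and convergence of `p`-power iterates -/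

section ResidueField

variable {K : Type*} [NormedField K] [IsUltrametricDist K]

theorem residue_eq_iff_norm_sub_lt_one
    (x y : (NormedField.valuation (K := K)).valuationSubring) :
    IsLocalRing.residue _ x = IsLocalRing.residue _ y ↔ ‖(x : K) - y‖ < 1 := by
  rw [← sub_eq_zero, ← map_sub, IsLocalRing.residue_eq_zero_iff,
    ValuationSubring.valuation_lt_one_iff,
    ← (Valuation.isEquiv_valuation_valuationSubring _).lt_one_iff_lt_one]
  simp [NormedField.valuation_apply, ← NNReal.coe_lt_coe]

theorem exists_dvd_iff_norm_pow_sub_one_lt_one {u : K} (hu : ‖u‖ = 1) {n : ℕ} (hn : 0 < n)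
    (h : ‖u ^ n - 1‖ < 1) :
    ∃ k : ℕ, 0 < k ∧ k ∣ n ∧ ∀ m : ℕ, ‖u ^ m - 1‖ < 1 ↔ k ∣ m := by
  let v : (NormedField.valuation (K := K)).valuationSubring :=
    ⟨u, by simp [Valuation.mem_valuationSubring_iff, NormedField.valuation_apply,
      ← NNReal.coe_le_coe, hu]⟩
  have key (m : ℕ) : ‖u ^ m - 1‖ < 1 ↔ orderOf (IsLocalRing.residue _ v) ∣ m := by
    rw [orderOf_dvd_iff_pow_eq_one, ← map_pow, ← map_one (IsLocalRing.residue _),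
      residue_eq_iff_norm_sub_lt_one]
    simp [v]
  have hd := (key n).1 h
  exact ⟨_, Nat.pos_of_dvd_of_pos hd hn, hd, key⟩

/-- If the trace of a norm one element is congruent to an integer modulo the maximal ideal, then
its residue satisfies `uᵖ = u⁻¹` or lies in the prime field. -/
theorem norm_pow_succ_sub_one_lt_one_or (p : ℕ) [hp : Fact p.Prime] (hpK : ‖(p : K)‖ < 1)
    {u : K} (hu : ‖u‖ = 1) {t : ℕ} (ht : ‖u + u⁻¹ - t‖ < 1) :
    ‖u ^ (p + 1) - 1‖ < 1 ∨ ∃ n : ℕ, ‖u - n‖ < 1 := by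
  let O := (NormedField.valuation (K := K)).valuationSubring
  have hmem (x : K) : x ∈ O ↔ ‖x‖ ≤ 1 := by
    simp [O, Valuation.mem_valuationSubring_iff, NormedField.valuation_apply,
      ← NNReal.coe_le_coe]
  let v : O := ⟨u, (hmem _).2 hu.le⟩
  let w : O := ⟨u⁻¹, (hmem _).2 (by simp [hu])⟩
  let F := IsLocalRing.ResidueField O
  let π : O →+* F := IsLocalRing.residue O
  have hπ (x y : O) : π x = π y ↔ ‖(x : K) - y‖ < 1 := residue_eq_iff_norm_sub_lt_one x y
  have hchar : CharP F p := by
    refine (CharP.charP_iff_prime_eq_zero hp.out).2 ?_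
    rw [← map_natCast π, ← map_zero π, hπ]
    simpa using hpK
  have hvw : π v * π w = 1 := by
    have hu0 : u ≠ 0 := norm_ne_zero_iff.1 (by simp [hu])
    rw [← map_mul, ← map_one π]
    congr 1
    exact Subtype.ext (mul_inv_cancel₀ hu0)
  have hsum : π v + π w = (t : F) := by
    rw [← map_add, ← map_natCast π, hπ]
    simpa [v, w] using ht
  have hsump : π v ^ p + π w ^ p = (t : F) := by
    rw [← add_pow_char, hsum, ← map_natCast (ZMod.castHom dvd_rfl F) t, ← map_pow, ZMod.pow_card]
  have hvwp : π v ^ p * π w ^ p = 1 := by rw [← mul_pow, hvw, one_pow]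
  -- Both `π v` and its Frobenius image are roots of `X² - tX + 1 = (X - π v)(X - π w)`.
  have hfac : (π v ^ p - π v) * (π v ^ p - π w) = 0 := by
    linear_combination hvw - hvwp + π v ^ p * (hsump - hsum)
  rcases mul_eq_zero.1 hfac with h | h
  · right
    rw [sub_eq_zero, ← Subfield.mem_bot_iff_pow_eq_self F p,
      ← ZMod.fieldRange_castHom_eq_bot p] at h
    obtain ⟨r, hr⟩ := h
    refine ⟨r.val, ?_⟩
    have : π v = π ((r.val : ℕ) : O) := by
      rw [map_natCast, ← hr]
      conv_lhs => rw [← ZMod.natCast_zmod_val r]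
      exact map_natCast _ _
    have hlt := (hπ _ _).1 this
    rwa [show (((r.val : ℕ) : O) : K) = ((r.val : ℕ) : K) from map_natCast O.subtype _] at hlt
  · left
    have : π (v ^ (p + 1)) = π 1 := by
      rw [map_pow, pow_succ, sub_eq_zero.1 h, mul_comm, hvw, map_one]
    simpa [v] using (hπ _ _).1 this

/-- Factor out `w - 1`; the cofactor `∑ wⁱ` is `p` plus a sum of terms `wⁱ - 1`, each divisible by
`w - 1`. -/
theorem norm_pow_prime_sub_one_le (p : ℕ) {w : K} (hw : ‖w - 1‖ ≤ 1) :
    ‖w ^ p - 1‖ ≤ ‖w - 1‖ * max ‖(p : K)‖ ‖w - 1‖ := by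
  have hw1 : ‖w‖ ≤ 1 := by
    have := IsUltrametricDist.norm_add_le_max (w - 1) 1
    rw [sub_add_cancel, norm_one] at this
    exact this.trans (max_le hw le_rfl)
  have hpow (i : ℕ) : ‖w ^ i - 1‖ ≤ ‖w - 1‖ := by
    rw [← geom_sum_mul, norm_mul]
    refine mul_le_of_le_one_left (norm_nonneg _) ?_
    refine IsUltrametricDist.norm_sum_le_of_forall_le_of_nonneg zero_le_one fun j _ => ?_
    rw [norm_pow]
    exact pow_le_one₀ (norm_nonneg _) hw1
  rw [← mul_geom_sum, norm_mul]
  gcongr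
  have e : ∑ i ∈ Finset.range p, w ^ i = p + ∑ i ∈ Finset.range p, (w ^ i - 1) := by
    simp
  rw [e]
  refine (IsUltrametricDist.norm_add_le_max _ _).trans (max_le_max le_rfl ?_)
  exact IsUltrametricDist.norm_sum_le_of_forall_le_of_nonneg (norm_nonneg _) fun j _ => hpow j

theorem tendsto_norm_pow_prime_pow_sub_one {p : ℕ} (hpK : ‖(p : K)‖ < 1) {w : K}
    (hw : ‖w - 1‖ < 1) :
    Tendsto (fun s : ℕ => ‖w ^ p ^ s - 1‖) atTop (𝓝 0) := by
  set ρ := max ‖(p : K)‖ ‖w - 1‖ with hρ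
  have hρ0 : 0 ≤ ρ := (norm_nonneg _).trans (le_max_left _ _)
  have hρ1 : ρ < 1 := max_lt hpK hw
  have key (s : ℕ) : ‖w ^ p ^ s - 1‖ ≤ ‖w - 1‖ * ρ ^ s := by
    induction s with
    | zero => simp
    | succ s ih =>
      have hle : ‖w ^ p ^ s - 1‖ ≤ ‖w - 1‖ :=
        ih.trans (mul_le_of_le_one_right (norm_nonneg _) (pow_le_one₀ hρ0 hρ1.le))
      rw [pow_succ, pow_mul]
      calc _ ≤ ‖w ^ p ^ s - 1‖ * max ‖(p : K)‖ ‖w ^ p ^ s - 1‖ :=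
            norm_pow_prime_sub_one_le p (hle.trans hw.le)
        _ ≤ (‖w - 1‖ * ρ ^ s) * ρ := by
            gcongr
            exact max_le_max le_rfl hle
        _ = _ := by ring
  refine squeeze_zero (fun _ => norm_nonneg _) key ?_
  simpa using (tendsto_pow_atTop_nhds_zero_of_lt_one hρ0 hρ1).const_mul ‖w - 1‖

end ResidueField

theorem norm_sub_le_max_of_ultrametric {K : Type*} [SeminormedAddCommGroup K]
    [IsUltrametricDist K] (x y : K) : ‖x - y‖ ≤ max ‖x‖ ‖y‖ := by
  simpa [sub_eq_add_neg] using IsUltrametricDist.norm_add_le_max x (-y)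

/-! ### The coordinate sending the fixed points to `0` and `∞` -/

section MobiusCoordinate

variable {k K : Type*} [Field k] [Field K] [Algebra k K]

/-- The coordinate `(x - α) / (x - β)` on the projective line over `k`. -/
noncomputable def mobiusCoordinate (α β : K) (x : OnePoint k) : K :=
  x.elim 1 fun x => (algebraMap k K x - α) / (algebraMap k K x - β)

theorem mobiusCoordinate_infty (α β : K) :
    mobiusCoordinate α β (OnePoint.infty : OnePoint k) = 1 := rfl

theorem mobiusCoordinate_coe (α β : K) (x : k) :
    mobiusCoordinate α β (x : OnePoint k) =
      (algebraMap k K x - α) / (algebraMap k K x - β) := rfl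

variable {α β : K}

theorem mobiusCoordinate_ne_zero (hα : α ∉ Set.range (algebraMap k K))
    (hβ : β ∉ Set.range (algebraMap k K)) (x : OnePoint k) : mobiusCoordinate α β x ≠ 0 := by
  induction x with
  | infty => exact one_ne_zero
  | coe x =>
    exact div_ne_zero (sub_ne_zero.2 fun h => hα ⟨x, h⟩) (sub_ne_zero.2 fun h => hβ ⟨x, h⟩)

theorem mobiusCoordinate_injective (hβ : β ∉ Set.range (algebraMap k K)) (hαβ : α ≠ β) :
    Function.Injective (mobiusCoordinate α β : OnePoint k → K) := by
  have hx (x : k) : algebraMap k K x - β ≠ 0 := sub_ne_zero.2 fun h => hβ ⟨x, h⟩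
  have h1 (x : k) : mobiusCoordinate α β (x : OnePoint k) ≠ 1 := by
    rw [mobiusCoordinate_coe, Ne, div_eq_one_iff_eq (hx x)]
    exact fun h => hαβ (sub_right_injective h)
  intro x y hxy
  induction x with
  | infty =>
    induction y with
    | infty => rfl
    | coe y => exact absurd hxy.symm (h1 y)
  | coe x =>
    induction y with
    | infty => exact absurd hxy (h1 x)
    | coe y =>
      rw [mobiusCoordinate_coe, mobiusCoordinate_coe, div_eq_div_iff (hx x) (hx y)] at hxy
      have : (α - β) * (algebraMap k K x - algebraMap k K y) = 0 := by linear_combination hxy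
      have := (mul_eq_zero.1 this).resolve_left (sub_ne_zero.2 hαβ)
      rw [(algebraMap k K).injective (sub_eq_zero.1 this)]

/-- In the coordinate built from its two fixed points, a homographic map is a multiplication. -/
theorem mobiusCoordinate_homographic [DecidableEq k] {a b c d : k} (hdet : a * d - b * c ≠ 0)
    (hc : c ≠ 0) (hβ : β ∉ Set.range (algebraMap k K))
    (hfα : algebraMap k K c * α ^ 2 + (algebraMap k K d - algebraMap k K a) * α
      - algebraMap k K b = 0)
    (hfβ : algebraMap k K c * β ^ 2 + (algebraMap k K d - algebraMap k K a) * β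
      - algebraMap k K b = 0) (x : OnePoint k) :
    mobiusCoordinate α β (homographic a b c d hdet x) =
      (algebraMap k K a - algebraMap k K c * α) / (algebraMap k K a - algebraMap k K c * β) *
        mobiusCoordinate α β x := by
  have hc' : algebraMap k K c ≠ 0 := by simpa using hc
  have hx (x : k) : algebraMap k K x - β ≠ 0 := sub_ne_zero.2 fun h => hβ ⟨x, h⟩
  have hcβ : algebraMap k K a - algebraMap k K c * β ≠ 0 := fun h =>
    hβ ⟨a / c, by rw [map_div₀, div_eq_iff hc']; linear_combination h⟩
  induction x with
  | infty =>
    rw [homographic_infty, if_neg hc, mobiusCoordinate_coe, mobiusCoordinate_infty, mul_one,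
      div_eq_div_iff (hx _) hcβ, map_div₀]
    field_simp
  | coe x =>
    rw [homographic_coe]
    split_ifs with h0
    · have h0' : algebraMap k K c * algebraMap k K x + algebraMap k K d = 0 := by
        rw [← map_mul, ← map_add, h0, map_zero]
      rw [mobiusCoordinate_coe, mobiusCoordinate_infty, div_mul_div_comm, eq_comm,
        div_eq_one_iff_eq (mul_ne_zero hcβ (hx x))]
      linear_combination (β - α) * h0' + hfα - hfβ
    · have h0' : algebraMap k K c * algebraMap k K x + algebraMap k K d ≠ 0 := by
        rwa [← map_mul, ← map_add, Ne, map_eq_zero]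
      have key (γ : K) (hγ : algebraMap k K c * γ ^ 2 + (algebraMap k K d - algebraMap k K a) * γ
          - algebraMap k K b = 0) : algebraMap k K ((a * x + b) / (c * x + d)) - γ =
          (algebraMap k K a - algebraMap k K c * γ) * (algebraMap k K x - γ) /
            (algebraMap k K c * algebraMap k K x + algebraMap k K d) := by
        rw [eq_div_iff h0', map_div₀, map_add, map_mul, map_add, map_mul, sub_mul,
          div_mul_cancel₀ _ h0']
        linear_combination -hγ
      rw [mobiusCoordinate_coe, mobiusCoordinate_coe, key α hfα, key β hfβ,
        div_div_div_cancel_right₀ h0', div_mul_div_comm]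

end MobiusCoordinate

theorem continuous_mobiusCoordinate {k K : Type*} [NontriviallyNormedField k] [ProperSpace k]
    [NormedField K] [NormedAlgebra k K] {α β : K} (hβ : β ∉ Set.range (algebraMap k K)) :
    Continuous (mobiusCoordinate α β : OnePoint k → K) := by
  have hx (x : k) : algebraMap k K x - β ≠ 0 := sub_ne_zero.2 fun h => hβ ⟨x, h⟩
  have halg : Continuous (algebraMap k K) := continuous_algebraMap k K
  rw [OnePoint.continuous_iff]
  constructor
  · simp only [mobiusCoordinate_infty, mobiusCoordinate_coe, coclosedCompact_eq_cocompact]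
    have e (x : k) : (algebraMap k K x - α) / (algebraMap k K x - β) =
        1 + (β - α) * (algebraMap k K x - β)⁻¹ := by
      have := hx x
      field_simp
      ring
    simp only [e]
    have hnorm : Tendsto (fun x : k => ‖algebraMap k K x - β‖) (cocompact k) atTop := by
      refine tendsto_atTop_mono (fun x => ?_)
        (tendsto_atTop_add_const_right _ (-‖β‖) (tendsto_norm_cocompact_atTop (E := k)))
      have := norm_sub_norm_le (algebraMap k K x) β
      rw [norm_algebraMap'] at this
      linarith
    have hinv : Tendsto (fun x : k => (algebraMap k K x - β)⁻¹) (cocompact k) (𝓝 0) := by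
      rw [tendsto_zero_iff_norm_tendsto_zero]
      simpa only [norm_inv] using! tendsto_inv_atTop_zero.comp hnorm
    simpa using (hinv.const_mul (β - α)).const_add 1
  · simp only [mobiusCoordinate_coe]
    exact (halg.sub continuous_const).div (halg.sub continuous_const) hx

/-! ### The multiplier modulo the maximal ideal -/

section Multiplier

variable {p : ℕ} [hp : Fact p.Prime]

theorem PadicAlgCl.norm_algEquiv (σ : Gal(PadicAlgCl p/ℚ_[p])) (x : PadicAlgCl p) :
    ‖σ x‖ = ‖x‖ :=
  (spectralNorm_eq_of_equiv σ x).symm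

theorem PadicAlgCl.norm_natCast_prime_lt_one : ‖(p : PadicAlgCl p)‖ < 1 := by
  rw [← map_natCast (algebraMap ℚ_[p] (PadicAlgCl p)), norm_algebraMap']
  exact Padic.norm_p_lt_one

theorem PadicAlgCl.norm_eq_one_of_algEquiv_eq_inv {u : PadicAlgCl p} (hu0 : u ≠ 0)
    {σ : Gal(PadicAlgCl p/ℚ_[p])} (hσ : σ u = u⁻¹) : ‖u‖ = 1 := by
  have h := PadicAlgCl.norm_algEquiv σ u
  have hpos : 0 < ‖u‖ := norm_pos_iff.2 hu0
  rw [hσ, norm_inv, inv_eq_iff_eq_inv] at h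
  have h : ‖u‖ ^ 2 = 1 := by
    rw [sq]
    nth_rewrite 1 [h]
    exact inv_mul_cancel₀ hpos.ne'
  exact (pow_eq_one_iff_of_nonneg hpos.le two_ne_zero).1 h

/-- A norm one element of a quadratic extension of `ℚ_[p]` has order dividing `p + 1` modulo the
maximal ideal. -/
theorem PadicAlgCl.norm_pow_succ_sub_one_lt_one {u : PadicAlgCl p}
    (σ : Gal(PadicAlgCl p/ℚ_[p])) (hσ : σ u = u⁻¹) {t : ℚ_[p]}
    (ht : u + u⁻¹ = algebraMap _ _ t) (hu : ‖u‖ = 1) : ‖u ^ (p + 1) - 1‖ < 1 := by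
  have hu0 : u ≠ 0 := norm_ne_zero_iff.1 (by simp [hu])
  have htn : ‖t‖ ≤ 1 := by
    rw [← norm_algebraMap' (PadicAlgCl p) t, ← ht]
    exact (IsUltrametricDist.norm_add_le_max _ _).trans (by simp [hu])
  obtain ⟨y, rfl⟩ : ∃ y : ℤ_[p], (y : ℚ_[p]) = t := ⟨⟨t, htn⟩, rfl⟩
  have htm : ‖u + u⁻¹ - (y.zmodRepr : ℕ)‖ < 1 := by
    rw [ht, ← map_natCast (algebraMap ℚ_[p] (PadicAlgCl p)), ← map_sub, norm_algebraMap',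
      ← PadicInt.coe_natCast, ← PadicInt.coe_sub, ← PadicInt.norm_def]
    exact PadicInt.norm_sub_zmodRepr_lt_one y
  rcases norm_pow_succ_sub_one_lt_one_or p PadicAlgCl.norm_natCast_prime_lt_one hu htm with h | h
  · exact h
  · obtain ⟨n, hn⟩ := h
    -- The isometry `σ` fixes `n` and inverts `u`, so `u` and `u⁻¹` have the same residue.
    have hn' : ‖u⁻¹ - n‖ < 1 := by
      rw [← hσ, ← map_natCast σ n, ← map_sub, PadicAlgCl.norm_algEquiv]
      exact hn
    have hdiff : ‖u ^ 2 - 1‖ < 1 := by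
      have e : u ^ 2 - 1 = u * ((u - n) - (u⁻¹ - n)) := by field_simp; ring
      rw [e, norm_mul, hu, one_mul]
      exact (norm_sub_le_max_of_ultrametric _ _).trans_lt (max_lt hn hn')
    -- For odd `p`, `2 ∣ p + 1` suffices. For `p = 2`, `u² ≡ 1` reads `(u - 1)² ≡ 0`, whence `u ≡
    -- 1`.
    rcases hp.out.eq_two_or_odd' with h2 | hodd
    · have hnat : ‖u * (u ^ 2 - 1)‖ < 1 := by rwa [norm_mul, hu, one_mul]
      have hd : ‖u - 1‖ < 1 := by
        have e : (u - 1) ^ 2 = (u ^ 2 - 1) - ((p : ℕ) : PadicAlgCl p) * (u - 1) := by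
          have hp2 : (p : PadicAlgCl p) = 2 := by exact_mod_cast congrArg (Nat.cast) h2
          rw [hp2]; ring
        have hle : ‖u - 1‖ ≤ 1 :=
          (norm_sub_le_max_of_ultrametric _ _).trans (by simp [hu])
        have : ‖u - 1‖ ^ 2 < 1 := by
          rw [← norm_pow, e]
          refine (norm_sub_le_max_of_ultrametric _ _).trans_lt (max_lt hdiff ?_)
          rw [norm_mul]
          exact (mul_le_of_le_one_right (norm_nonneg _) hle).trans_lt
            PadicAlgCl.norm_natCast_prime_lt_one
        exact (sq_lt_one_iff₀ (norm_nonneg _)).1 this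
      have := norm_pow_sub_one_le_of_dvd hu (one_dvd (p + 1))
      rw [pow_one] at this
      exact this.trans_lt hd
    · exact (norm_pow_sub_one_le_of_dvd hu hodd.add_one.two_dvd).trans_lt hdiff

end Multiplier

theorem homographic_fixed_iff {k : Type*} [Field k] [DecidableEq k] {a b c d : k}
    (hdet : a * d - b * c ≠ 0) (x : k) :
    homographic a b c d hdet x = x ↔ c * x ^ 2 + (d - a) * x - b = 0 := by
  rw [homographic_coe]
  split_ifs with h0
  · refine iff_of_false (OnePoint.infty_ne_coe _) fun h => hdet ?_
    linear_combination (a - c * x) * h0 + c * h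
  · rw [OnePoint.coe_eq_coe, div_eq_iff h0]
    constructor <;> intro h <;> linear_combination -h

/-! ### Conjugate fixed points and eigenvalues -/

section Eigenvalues

/-- A homographic map without rational fixed points has two conjugate fixed points; the quotient
of the corresponding eigenvalues is inverted by the conjugation and has a rational trace. -/
theorem exists_conjugate_fixedPoints {k L : Type*} [Field k] [DecidableEq k] [Field L]
    [Algebra k L] [IsAlgClosed L] [IsGalois k L] {a b c d : k} (hdet : a * d - b * c ≠ 0)
    (hc : c ≠ 0) (hfix : ∀ x : OnePoint k, homographic a b c d hdet x ≠ x) :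
    ∃ (α β u : L) (σ : Gal(L/k)) (t : k), α ∉ Set.range (algebraMap k L) ∧
      β ∉ Set.range (algebraMap k L) ∧ β ≠ α ∧
      algebraMap k L c * α ^ 2 + (algebraMap k L d - algebraMap k L a) * α
        - algebraMap k L b = 0 ∧
      algebraMap k L c * β ^ 2 + (algebraMap k L d - algebraMap k L a) * β
        - algebraMap k L b = 0 ∧
      u = (algebraMap k L a - algebraMap k L c * α) /
        (algebraMap k L a - algebraMap k L c * β) ∧
      u ≠ 0 ∧ σ u = u⁻¹ ∧ u + u⁻¹ = algebraMap k L t := by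
  set ι := algebraMap k L with hι
  have hιc : ι c ≠ 0 := (map_ne_zero ι).2 hc
  obtain ⟨α, hα⟩ : ∃ α : L, ι c * α ^ 2 + (ι d - ι a) * α - ι b = 0 := by
    obtain ⟨α, hα⟩ := IsAlgClosed.exists_root
      (Polynomial.C (ι c) * Polynomial.X ^ 2 + Polynomial.C (ι d - ι a) * Polynomial.X
        + Polynomial.C (-ι b)) (by rw [Polynomial.degree_quadratic hιc]; decide)
    refine ⟨α, ?_⟩
    simpa [Polynomial.IsRoot, sub_eq_add_neg] using hα
  have hnot (γ : L) (hγ : ι c * γ ^ 2 + (ι d - ι a) * γ - ι b = 0) : γ ∉ Set.range ι := by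
    rintro ⟨x, rfl⟩
    refine hfix x ((homographic_fixed_iff hdet x).2 (ι.injective ?_))
    simpa using hγ
  have hαr := hnot α hα
  obtain ⟨σ, hσ⟩ : ∃ σ : Gal(L/k), σ α ≠ α := by
    by_contra! h
    exact hαr ((InfiniteGalois.mem_range_algebraMap_iff_fixed α).2 h)
  set β := σ α with hβdef
  have hσι (x : k) : σ (ι x) = ι x := σ.commutes x
  have hβ : ι c * β ^ 2 + (ι d - ι a) * β - ι b = 0 := by
    simpa [hσι] using congrArg σ hα
  have hβr := hnot β hβ
  have hsum : ι c * (α + β) + (ι d - ι a) = 0 := by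
    refine (mul_eq_zero.1 (?_ : (β - α) * _ = 0)).resolve_left (sub_ne_zero.2 hσ)
    linear_combination hβ - hα
  have hprod : (ι a - ι c * α) * (ι a - ι c * β) = ι (a * d - b * c) := by
    simp only [map_sub, map_mul]
    linear_combination (- ι a + ι c * α) * hsum - ι c * hα
  have hΔ : ι (a * d - b * c) ≠ 0 := (map_ne_zero ι).2 hdet
  have hα0 : ι a - ι c * α ≠ 0 := fun h => hΔ (by rw [← hprod, h, zero_mul])
  have hβ0 : ι a - ι c * β ≠ 0 := fun h => hΔ (by rw [← hprod, h, mul_zero])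
  have hσβ : σ β = α := by
    have := congrArg σ hsum
    simp only [map_add, map_mul, map_sub, map_zero, hσι, ← hβdef] at this
    exact mul_left_cancel₀ hιc (by linear_combination this - hsum)
  obtain ⟨u, hu_def⟩ : ∃ u : L, u = (ι a - ι c * α) / (ι a - ι c * β) := ⟨_, rfl⟩
  have hσu : σ u = u⁻¹ := by
    rw [hu_def, inv_div]
    simp only [map_div₀, map_sub, map_mul, hσι, hσβ, ← hβdef]
  have hu0 : u ≠ 0 := hu_def ▸ div_ne_zero hα0 hβ0
  -- The eigenvalues `a - cα`, `a - cβ` have sum `a + d` and product `ad - bc`; the trace is the sum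
  -- of their squares over their product.
  have htrace : u + u⁻¹ = ι (((a + d) ^ 2 - 2 * (a * d - b * c)) / (a * d - b * c)) := by
    rw [hu_def, inv_div, div_add_div _ _ hβ0 hα0, map_div₀, ← hprod,
      mul_comm (ι a - ι c * β)]
    congr 1
    · simp only [map_sub, map_mul, map_pow, map_add, map_ofNat] at hprod ⊢
      linear_combination (-2 : L) * hprod + (ι c * (α + β) - 3 * ι a - ι d) * hsum
    · ring
  exact ⟨α, β, u, σ, _, hαr, hβr, hσ, hα, hβ, hu_def, hu0, hσu, htrace⟩

end Eigenvalues

/-! ### Assembly -/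

/-- The minimal subsystems of a homographic map with fixed points `α`, `β` in an extension `K`,
whose ratio of eigenvalues `u` satisfies `uᵖ⁺¹ ≡ 1` modulo the maximal ideal. -/
theorem exists_odometer_conjugacy_of_fixedPoints {p : ℕ} [hp : Fact p.Prime]
    [DecidableEq ℚ_[p]] {K : Type*} [NormedField K] [NormedAlgebra ℚ_[p] K]
    [IsUltrametricDist K] [CompleteSpace K] {a b c d : ℚ_[p]} (hdet : a * d - b * c ≠ 0)
    (hiter : ∀ n : ℕ, 0 < n → (homographic a b c d hdet)^[n] ≠ id) (hc : c ≠ 0)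
    {α β u : K} (hα : α ∉ Set.range (algebraMap ℚ_[p] K))
    (hβ : β ∉ Set.range (algebraMap ℚ_[p] K)) (hαβ : α ≠ β)
    (hfα : algebraMap ℚ_[p] K c * α ^ 2 + (algebraMap ℚ_[p] K d - algebraMap ℚ_[p] K a) * α
      - algebraMap ℚ_[p] K b = 0)
    (hfβ : algebraMap ℚ_[p] K c * β ^ 2 + (algebraMap ℚ_[p] K d - algebraMap ℚ_[p] K a) * β
      - algebraMap ℚ_[p] K b = 0)
    (hu_def : u = (algebraMap ℚ_[p] K a - algebraMap ℚ_[p] K c * α) /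
      (algebraMap ℚ_[p] K a - algebraMap ℚ_[p] K c * β))
    (hu : ‖u‖ = 1) (hup : ‖u ^ (p + 1) - 1‖ < 1) :
    ∃ (k : ℕ) (hk : 0 < k), k ∣ p + 1 ∧
      ∀ (E : Set (OnePoint ℚ_[p])) (hE : IsMinimalSubsystem (homographic a b c d hdet) E),
        TopologicallyConjugate
          (Set.MapsTo.restrict (homographic a b c d hdet) E E hE.mapsTo)
          (addingMachine (geometricScale k p hk hp.out.pos)) := by
  have hinj : Function.Injective (mobiusCoordinate α β : OnePoint ℚ_[p] → K) :=
    mobiusCoordinate_injective hβ hαβ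
  have hconj (x : OnePoint ℚ_[p]) : mobiusCoordinate α β (homographic a b c d hdet x) =
      u * mobiusCoordinate α β x := by
    rw [hu_def, mobiusCoordinate_homographic hdet hc hβ hfα hfβ x]
  have hroot (n : ℕ) (hn : 0 < n) : u ^ n ≠ 1 := by
    intro h1
    refine hiter n hn (funext fun x => hinj ?_)
    have hpow (m : ℕ) : mobiusCoordinate α β ((homographic a b c d hdet)^[m] x) =
        u ^ m * mobiusCoordinate α β x := by
      induction m with
      | zero => simp
      | succ m ih => rw [Function.iterate_succ_apply', hconj, ih]; ring
    rw [hpow, h1, one_mul, id]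
  obtain ⟨k, hk, hkp, hkm⟩ := exists_dvd_iff_norm_pow_sub_one_lt_one hu p.succ_pos hup
  have hpK : ‖(p : K)‖ < 1 := by
    rw [← map_natCast (algebraMap ℚ_[p] K), norm_algebraMap']
    exact Padic.norm_p_lt_one
  have hlim : Tendsto (fun s => ‖u ^ (k * p ^ s) - 1‖) atTop (𝓝 0) := by
    have h1 : ‖u ^ k - 1‖ < 1 := (hkm k).2 dvd_rfl
    simpa only [pow_mul] using tendsto_norm_pow_prime_pow_sub_one hpK h1
  have hpinj := odometerPow_injective hk hp.out hu hlim hroot fun n => (hkm n).1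
  refine ⟨k, hk, hkp, fun E hE => ?_⟩
  have hcont : Continuous (mobiusCoordinate α β : OnePoint ℚ_[p] → K) :=
    continuous_mobiusCoordinate hβ
  have hne := mobiusCoordinate_ne_zero (k := ℚ_[p]) hα hβ
  have hlim' : Tendsto (fun s => ‖u ^ (geometricScale k p hk hp.out.pos).seq s - 1‖) atTop (𝓝 0) :=
    hlim
  exact topologicallyConjugate_of_odometerPow hu hlim' hpinj hcont hinj hne hconj hE

theorem theorem2 (p : ℕ) [hp : Fact p.Prime] [DecidableEq ℚ_[p]] (a b c d : ℚ_[p])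
    (hdet : a * d - b * c ≠ 0)
    (hfix : ∀ x : OnePoint ℚ_[p], homographic a b c d hdet x ≠ x)
    (hiter : ∀ n : ℕ, 0 < n → (homographic a b c d hdet)^[n] ≠ id) :
    ∃ (k : ℕ) (hk : 0 < k), k ∣ p + 1 ∧
      ∀ (E : Set (OnePoint ℚ_[p])) (hE : IsMinimalSubsystem (homographic a b c d hdet) E),
        TopologicallyConjugate
          (Set.MapsTo.restrict (homographic a b c d hdet) E E hE.mapsTo)
          (addingMachine (geometricScale k p hk hp.out.pos)) := by
  have hc : c ≠ 0 := fun h => hfix OnePoint.infty (by rw [homographic_infty, if_pos h])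
  obtain ⟨α, β, u, σ, t, hα, hβ, hne, hfα, hfβ, hu_def, hu0, hσu, htrace⟩ :=
    exists_conjugate_fixedPoints (L := PadicAlgCl p) hdet hc hfix
  have hu := PadicAlgCl.norm_eq_one_of_algEquiv_eq_inv hu0 hσu
  have hup := PadicAlgCl.norm_pow_succ_sub_one_lt_one σ hσu htrace hu
  -- Galois conjugation lives on the algebraic closure, but the limits defining `odometerPow` need
  -- completeness, so the data moves isometrically to `ℂ_[p]`.
  obtain ⟨j, hjn, hjι⟩ : ∃ j : PadicAlgCl p →+* ℂ_[p], (∀ x, ‖j x‖ = ‖x‖) ∧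
      ∀ x, j (algebraMap ℚ_[p] (PadicAlgCl p) x) = algebraMap ℚ_[p] ℂ_[p] x :=
    ⟨algebraMap (PadicAlgCl p) ℂ_[p], fun x => norm_algebraMap' _ x,
      fun x => (IsScalarTower.algebraMap_apply ℚ_[p] (PadicAlgCl p) ℂ_[p] x).symm⟩
  have hjr {γ : PadicAlgCl p} (hγ : γ ∉ Set.range (algebraMap ℚ_[p] (PadicAlgCl p))) :
      j γ ∉ Set.range (algebraMap ℚ_[p] ℂ_[p]) := by
    rintro ⟨x, hx⟩
    exact hγ ⟨x, j.injective (by rw [hjι, hx])⟩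
  refine exists_odometer_conjugacy_of_fixedPoints (u := j u) hdet hiter hc (hjr hα) (hjr hβ)
    (fun h => hne (j.injective h).symm) ?_ ?_ ?_ ((hjn u).trans hu) ?_
  · simpa only [map_sub, map_add, map_mul, map_pow, map_zero, hjι] using congrArg j hfα
  · simpa only [map_sub, map_add, map_mul, map_pow, map_zero, hjι] using congrArg j hfβ
  · simpa only [map_sub, map_div₀, map_mul, hjι] using congrArg j hu_def
  · rwa [← map_pow, ← map_one j, ← map_sub, hjn]
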